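/- Let $\mathcal C$ be an abelian braided monoidal category with braiding $\Psi$, in which $\otimes$ is additive in each variable, countable coproducts exist, and $\otimes$ preserves (small) colimits in each variable. Let $V$ be an object of $\mathcal C$. On $V^{\otimes n}$ let $\Psi_i$ be the braiding of the factors $i,i+1$, and define $$[n,\Psi]=\mathrm{id}+\Psi_{n-1}+\Psi_{n-1}\Psi_{n-2}+\cdots+\Psi_{n-1}\cdots\Psi_1,\qquad [0,\Psi]!=\mathrm{id},\quad [n,\Psi]!=([n-1,\Psi]!\otimes\mathrm{id})\circ[n,\Psi].$$ Let $B=B_+(V)=TV/\bigoplus_n\ker[n,\Psi]!$ and $\Lambda=\Lambda(V)=TV/\langle\mathrm{Im}(\mathrm{id}+\Psi)\rangle$, where $TV$ is the tensor algebra and $\langle\ \rangle$ denotes the two-sided ideal generated. Let $\Omega=\bigoplus_{p,q}\Omega^{p,q}$, $\Omega^{p,q}=\Lambda^p\otimes B\otimes\Lambda^q$, be the bigraded algebra $\Lambda\underline\otimes B\underline\otimes\Lambda$ given by the braided super tensor product. That is, $\Lambda\underline\otimes B$ has the product $(\lambda\otimes b)(\lambda'\otimes b')=\lambda\,\Psi(b\otimes\lambda')\,b'$,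 and for $x\in\Lambda^p\otimes B$, $\eta\in\Lambda^{q}$, $x'\in\Lambda^{p'}\otimes B$, $\eta'\in\Lambda^{q'}$ (in diagrammatic notation) $$(x\otimes\eta)\wedge(x'\otimes\eta')=(-1)^{qp'}\,x\,\Psi(\eta\otimes x')\,\eta'.$$ Each $\Omega^{p,q}$ is a $B$-bimodule by multiplication by $1\otimes b\otimes 1$. In particular $\Omega^{p,0}=\Lambda^p\otimes B$ and $\Omega^{0,q}=B\otimes\Lambda^q$. Then for all $p,q\ge 0$: 1. The wedge product descends to an isomorphism of $B$-bimodules $\wedge:\Omega^{p,0}\otimes_B\Omega^{0,q}\to\Omega^{p,q}$. Its inverse is $\lambda\otimes b\otimes\eta\mapsto(\lambda\otimes b)\otimes_B(1\otimes\eta)$, i.e. the isomorphism is the canonical identification $B\otimes_BB=B$. 2. The wedge product descends to an isomorphism of $B$-bimodules $\wedge:\Omega^{0,q}\otimes_B\Omega^{p,0}\to\Omega^{p,q}$. Its inverse is $(-1)^{pq}$ times the composite of the inverse braiding $$\Psi^{-1}_{\Lambda^q,\Lambda^p\otimes B}:\Lambda^p\otimes B\otimes\Lambda^q\to\Lambda^q\otimes\Lambda^p\otimes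 B$$ with the map $\eta\otimes\lambda\otimes b\mapsto(1\otimes\eta)\otimes_B(\lambda\otimes b)$ to $\Omega^{0,q}\otimes_B\Omega^{p,0}$. Hence the double complex $\Omega^{\bullet,\bullet}$ is factorisable, which means that both of these wedge products are $B$-bimodule isomorphisms for all $p,q$. -/

import Mathlib

open CategoryTheory MonoidalCategory Limits

universe v u

set_option linter.unusedSectionVars false

namespace BraidedPlane

/-- A monoid (algebra) in the monoidal category `C`, graded by the additive monoid `J`. The product
`mul h : X i ⊗ X j ⟶ X k` takes the equation `h : i + j = k` as an argument. -/
structure GradedMon (C : Type u) [Category.{v} C] [MonoidalCategory C] (J : Type) [AddMonoid J] where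
  X : J → C
  one : 𝟙_ C ⟶ X 0
  mul : ∀ {i j k : J}, i + j = k → (X i ⊗ X j ⟶ X k)
  one_mul : ∀ i, one ▷ X i ≫ mul (zero_add i) = (λ_ (X i)).hom
  mul_one : ∀ i, X i ◁ one ≫ mul (add_zero i) = (ρ_ (X i)).hom
  mul_assoc : ∀ {i j k ij jk ijk : J} (h₁ : i + j = ij) (h₂ : ij + k = ijk) (h₃ : j + k = jk)
    (h₄ : i + jk = ijk),
    mul h₁ ▷ X k ≫ mul h₂ = (α_ (X i) (X j) (X k)).hom ≫ X i ◁ mul h₃ ≫ mul h₄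

lemma GradedMon.one_mul_assoc {C : Type u} [Category.{v} C] [MonoidalCategory C] {J : Type}
    [AddMonoid J] (M : GradedMon C J) (i : J) {Z : C} (f : M.X i ⟶ Z) :
    M.one ▷ M.X i ≫ M.mul (zero_add i) ≫ f = (λ_ (M.X i)).hom ≫ f := by
  rw [← Category.assoc, M.one_mul]

lemma GradedMon.mul_one_assoc {C : Type u} [Category.{v} C] [MonoidalCategory C] {J : Type}
    [AddMonoid J] (M : GradedMon C J) (i : J) {Z : C} (f : M.X i ⟶ Z) :
    M.X i ◁ M.one ≫ M.mul (add_zero i) ≫ f = (ρ_ (M.X i)).hom ≫ f := by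
  rw [← Category.assoc, M.mul_one]

lemma GradedMon.mul_assoc_assoc {C : Type u} [Category.{v} C] [MonoidalCategory C] {J : Type}
    [AddMonoid J] (M : GradedMon C J) {i j k ij jk ijk : J} (h₁ : i + j = ij)
    (h₂ : ij + k = ijk) (h₃ : j + k = jk) (h₄ : i + jk = ijk) {Z : C} (f : M.X ijk ⟶ Z) :
    M.mul h₁ ▷ M.X k ≫ M.mul h₂ ≫ f =
      (α_ (M.X i) (M.X j) (M.X k)).hom ≫ M.X i ◁ M.mul h₃ ≫ M.mul h₄ ≫ f := by
  rw [← Category.assoc, M.mul_assoc h₁ h₂ h₃ h₄]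
  simp only [Category.assoc]


section TensorPowers

variable {C : Type u} [Category.{v} C] [MonoidalCategory C]

/-- The tensor power `V^{⊗n}`, with `V^{⊗(n+1)} = V^{⊗n} ⊗ V`. -/
@[reducible] def pow (V : C) : ℕ → C
  | 0 => 𝟙_ C
  | n + 1 => pow V n ⊗ V

/-- The canonical rebracketing `V^{⊗m} ⊗ V^{⊗n} ≅ V^{⊗(m+n)}` (concatenation). -/
def powMul (V : C) (m : ℕ) : ∀ n : ℕ, pow V m ⊗ pow V n ≅ pow V (m + n)
  | 0 => ρ_ (pow V m)
  | n + 1 => (α_ (pow V m) (pow V n) V).symm ≪≫ whiskerRightIso (powMul V m n) V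

lemma powMul_zero (V : C) (m : ℕ) : (powMul V m 0).hom = (ρ_ (pow V m)).hom := rfl

lemma powMul_succ (V : C) (m n : ℕ) : (powMul V m (n + 1)).hom =
    (α_ (pow V m) (pow V n) V).inv ≫ (powMul V m n).hom ▷ V := rfl

lemma eqToHom_pow_succ (V : C) {m n : ℕ} (h : m = n) (h' : pow V (m + 1) = pow V (n + 1)) :
    eqToHom h' = eqToHom (congrArg (pow V) h) ▷ V := by
  subst h; simp [pow]

lemma powMul_zero_left (V : C) (n : ℕ) :
    (powMul V 0 n).hom ≫ eqToHom (congrArg (pow V) (zero_add n)) = (λ_ (pow V n)).hom := by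
  induction n with
  | zero =>
    rw [powMul_zero, eqToHom_refl, Category.comp_id]
    exact unitors_equal.symm
  | succ n ih =>
    have e := eqToHom_pow_succ V (zero_add n) (congrArg (pow V) (zero_add (n + 1)))
    rw [powMul_succ]
    erw [e]
    rw [Category.assoc, ← comp_whiskerRight]
    erw [ih]
    simp [pow]

lemma powMul_assoc (V : C) (l m n : ℕ) :
    (powMul V l m).hom ▷ pow V n ≫ (powMul V (l + m) n).hom ≫
      eqToHom (congrArg (pow V) (add_assoc l m n)) =
    (α_ (pow V l) (pow V m) (pow V n)).hom ≫ pow V l ◁ (powMul V m n).hom ≫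
      (powMul V l (m + n)).hom := by
  induction n with
  | zero =>
    change (powMul V l m).hom ▷ 𝟙_ C ≫ (ρ_ (pow V (l + m))).hom ≫ 𝟙 (pow V (l + m)) =
      (α_ (pow V l) (pow V m) (𝟙_ C)).hom ≫ pow V l ◁ (ρ_ (pow V m)).hom ≫ (powMul V l m).hom
    simp
  | succ n ih =>
    rw [eqToHom_pow_succ V (add_assoc l m n) (congrArg (pow V) (add_assoc l m (n + 1)))]
    change (powMul V l m).hom ▷ (pow V n ⊗ V) ≫
      ((α_ (pow V (l + m)) (pow V n) V).inv ≫ (powMul V (l + m) n).hom ▷ V) ≫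
        eqToHom (congrArg (pow V) (add_assoc l m n)) ▷ V =
      (α_ (pow V l) (pow V m) (pow V n ⊗ V)).hom ≫
        pow V l ◁ ((α_ (pow V m) (pow V n) V).inv ≫ (powMul V m n).hom ▷ V) ≫
          (α_ (pow V l) (pow V (m + n)) V).inv ≫ (powMul V l (m + n)).hom ▷ V
    have h := congrArg (fun f => (α_ _ _ _).inv ≫ f ▷ V) ih
    simp only [comp_whiskerRight] at h
    rw [Category.assoc, associator_inv_naturality_left_assoc]
    refine h.trans ?_
    simp

/-- The tensor algebra `TV`, as an `ℕ`-graded monoid. -/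
@[reducible] def tensorAlgebra (V : C) : GradedMon C ℕ where
  X := pow V
  one := 𝟙 _
  mul h := (powMul V _ _).hom ≫ eqToHom (congrArg (pow V) h)
  one_mul i := by
    rw [id_whiskerRight, Category.id_comp, powMul_zero_left]
  mul_one i := by
    rw [MonoidalCategory.whiskerLeft_id, Category.id_comp, powMul_zero]; simp
  mul_assoc := by
    intro i j k ij jk ijk h₁ h₂ h₃ h₄
    subst h₁ h₂ h₃
    simp only [eqToHom_refl, Category.comp_id]
    have h := powMul_assoc V i j k
    rw [← reassoc_of% h]
    simp
end TensorPowers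

section Factorial

variable {C : Type u} [Category.{v} C] [MonoidalCategory C] [Preadditive C] [BraidedCategory C]

/-- The braiding `Ψ_{V,V}` applied to the last two tensor factors of `V^{⊗(n+2)}`. -/
def braidLast (V : C) (n : ℕ) : pow V (n + 2) ⟶ pow V (n + 2) :=
  (α_ (pow V n) V V).hom ≫ pow V n ◁ (β_ V V).hom ≫ (α_ (pow V n) V V).inv

/-- The braided integer `[n, Ψ] = id + Ψ_{n-1} + Ψ_{n-1}Ψ_{n-2} + ⋯ + Ψ_{n-1}⋯Ψ_1` on `V^{⊗n}`, where
`Ψ_i` is the braiding of the factors `i, i+1` and the rightmost operator is applied first. It is the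
`V^{⊗n} ⟶ V^{⊗(n-1)} ⊗ V` component of the coproduct of `TV` with `V` primitive. Recursively,
`[n+2, Ψ] = id + Ψ_{n+1} ∘ ([n+1, Ψ] ⊗ id)`. -/
def braidedInt (V : C) : ∀ n : ℕ, pow V n ⟶ pow V n
  | 0 => 0
  | 1 => 𝟙 _
  | n + 2 => 𝟙 _ + braidedInt V (n + 1) ▷ V ≫ braidLast V n

/-- The braided factorial `[n, Ψ]! : V^{⊗n} ⟶ V^{⊗n}`, with
`[n+1, Ψ]! = ([n, Ψ]! ⊗ id) ∘ [n+1, Ψ]`; it is the sum over all permutations of the braid lifts of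
their reduced words. -/
def braidedFactorial (V : C) : ∀ n : ℕ, pow V n ⟶ pow V n
  | 0 => 𝟙 _
  | n + 1 => braidedInt V (n + 1) ≫ braidedFactorial V n ▷ V

lemma braidedInt_add_two (V : C) (n : ℕ) :
    braidedInt V (n + 2) = 𝟙 _ + braidedInt V (n + 1) ▷ V ≫ braidLast V n := rfl

lemma braidedFactorial_succ (V : C) (n : ℕ) :
    braidedFactorial V (n + 1) = braidedInt V (n + 1) ≫ braidedFactorial V n ▷ V := rfl

lemma braidedFactorial_eqToHom (V : C) {m n : ℕ} (h : m = n) :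
    braidedFactorial V m ≫ eqToHom (congrArg (pow V) h) =
      eqToHom (congrArg (pow V) h) ≫ braidedFactorial V n := by
  subst h; simp

lemma braidLast_natural (V : C) (n : ℕ) (f : pow V n ⟶ pow V n) :
    braidLast V n ≫ f ▷ V ▷ V = f ▷ V ▷ V ≫ braidLast V n := by
  simp only [braidLast, Category.assoc]
  rw [← associator_inv_naturality_left, whisker_exchange_assoc, associator_naturality_left_assoc]

lemma braidedFactorial_one (V : C) : braidedFactorial V 1 = 𝟙 _ := by
  change 𝟙 (𝟙_ C ⊗ V) ≫ 𝟙 (𝟙_ C) ▷ V = 𝟙 (𝟙_ C ⊗ V)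
  simp

variable [MonoidalPreadditive C]

lemma braidedFactorial_succ_right (V : C) (n : ℕ) :
    ∃ z : pow V (n + 1) ⟶ pow V (n + 1),
      braidedFactorial V (n + 1) = braidedFactorial V n ▷ V ≫ z := by
  induction n with
  | zero =>
    refine ⟨𝟙 _, ?_⟩
    rw [braidedFactorial_one, Category.comp_id]
    exact (id_whiskerRight (𝟙_ C) V).symm
  | succ n ih =>
    obtain ⟨z, hz⟩ := ih
    refine ⟨𝟙 _ + braidLast V n ≫ z ▷ V, ?_⟩
    have h : braidLast V n ≫ braidedFactorial V (n + 1) ▷ V =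
        braidedFactorial V n ▷ V ▷ V ≫ braidLast V n ≫ z ▷ V := by
      rw [hz, comp_whiskerRight, ← Category.assoc, ← Category.assoc, braidLast_natural]
    have h2 : braidedFactorial V (n + 2) = braidedFactorial V (n + 1) ▷ V +
        braidedInt V (n + 1) ▷ V ≫ braidLast V n ≫ braidedFactorial V (n + 1) ▷ V := by
      rw [braidedFactorial_succ V (n + 1), braidedInt_add_two, Preadditive.add_comp,
        Category.id_comp, Category.assoc]
    rw [h2, h, Preadditive.comp_add, Category.comp_id, braidedFactorial_succ V n,
      comp_whiskerRight, Category.assoc]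

lemma powMul_braidedFactorial_right (V : C) (m n : ℕ) :
    ∃ z : pow V m ⊗ pow V n ⟶ pow V (m + n),
      (powMul V m n).hom ≫ braidedFactorial V (m + n) = braidedFactorial V m ▷ pow V n ≫ z := by
  induction n with
  | zero =>
    refine ⟨(ρ_ (pow V m)).hom, ?_⟩
    exact (rightUnitor_naturality (braidedFactorial V m)).symm
  | succ n ih =>
    obtain ⟨z, hz⟩ := ih
    obtain ⟨y, hy⟩ := braidedFactorial_succ_right V (m + n)
    refine ⟨(α_ (pow V m) (pow V n) V).inv ≫ z ▷ V ≫ y, ?_⟩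
    change ((α_ (pow V m) (pow V n) V).inv ≫ (powMul V m n).hom ▷ V) ≫
      braidedFactorial V (m + n + 1) = _
    rw [hy, Category.assoc, ← comp_whiskerRight_assoc, hz, comp_whiskerRight, Category.assoc,
      ← associator_inv_naturality_left_assoc]

/-- The rebracketing `V ⊗ V^{⊗n} ⟶ V^{⊗(n+1)}`. -/
def powCons (V : C) : ∀ n : ℕ, V ⊗ pow V n ⟶ pow V (n + 1)
  | 0 => (ρ_ V).hom ≫ (λ_ V).inv
  | n + 1 => (α_ V (pow V n) V).inv ≫ powCons V n ▷ V

lemma powCons_succ (V : C) (n : ℕ) :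
    powCons V (n + 1) = (α_ V (pow V n) V).inv ≫ powCons V n ▷ V := rfl

lemma powCons_braidLast (V : C) (n : ℕ) :
    powCons V (n + 2) ≫ braidLast V (n + 1) = V ◁ braidLast V n ≫ powCons V (n + 2) := by
  simp only [powCons_succ, braidLast, comp_whiskerRight, Category.assoc]
  rw [associator_naturality_left_assoc, ← whisker_exchange_assoc,
    associator_inv_naturality_left]
  simp

lemma powCons_braidedInt (V : C) (n : ℕ) :
    powCons V n ≫ braidedInt V (n + 1) = V ◁ braidedInt V n ≫ powCons V n +
      (β_ V (pow V n)).hom := by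
  induction n with
  | zero =>
    change ((ρ_ V).hom ≫ (λ_ V).inv) ≫ 𝟙 _ = V ◁ 0 ≫ ((ρ_ V).hom ≫ (λ_ V).inv) +
      (β_ V (𝟙_ C)).hom
    simp
  | succ n ih =>
    rw [braidedInt_add_two, Preadditive.comp_add, Category.comp_id]
    have h : powCons V (n + 1) ≫ braidedInt V (n + 1) ▷ V =
        (α_ V (pow V n) V).inv ≫ (V ◁ braidedInt V n) ▷ V ≫ powCons V n ▷ V +
        (α_ V (pow V n) V).inv ≫ (β_ V (pow V n)).hom ▷ V := by
      rw [powCons_succ, Category.assoc, ← comp_whiskerRight, ih]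
      simp
    have hb : (α_ V (pow V n) V).inv ≫ (β_ V (pow V n)).hom ▷ V ≫ braidLast V n =
        (β_ V (pow V (n + 1))).hom := by
      simp [braidLast, BraidedCategory.braiding_tensor_right_hom]
    rw [reassoc_of% h, Preadditive.add_comp, Category.assoc, Category.assoc, Category.assoc, hb,
      ← add_assoc]
    congr 1
    cases n with
    | zero =>
      change _ + (α_ V (𝟙_ C) V).inv ≫ (V ◁ (0 : 𝟙_ C ⟶ 𝟙_ C)) ▷ V ≫ _ = V ◁ 𝟙 _ ≫ _
      simp
    | succ n =>
      rw [braidedInt_add_two, MonoidalPreadditive.whiskerLeft_add, Preadditive.add_comp,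
        MonoidalCategory.whiskerLeft_id, Category.id_comp]
      congr 1
      rw [MonoidalCategory.whiskerLeft_comp, Category.assoc, ← powCons_braidLast,
        powCons_succ V (n + 1)]
      simp

lemma powCons_braidedFactorial (V : C) (n : ℕ) :
    ∃ y : V ⊗ pow V n ⟶ pow V (n + 1),
      powCons V n ≫ braidedFactorial V (n + 1) = V ◁ braidedFactorial V n ≫ y := by
  induction n with
  | zero =>
    refine ⟨powCons V 0, ?_⟩
    rw [braidedFactorial_one, Category.comp_id]
    change _ = V ◁ 𝟙 (𝟙_ C) ≫ _
    simp
  | succ n ih =>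
    obtain ⟨y, hy⟩ := ih
    refine ⟨(α_ V (pow V n) V).inv ≫ y ▷ V + (β_ V (pow V (n + 1))).hom, ?_⟩
    rw [braidedFactorial_succ V (n + 1), ← Category.assoc, powCons_braidedInt,
      Preadditive.add_comp, Preadditive.comp_add,
      BraidedCategory.braiding_naturality_right]
    congr 1
    rw [powCons_succ, Category.assoc, Category.assoc, ← comp_whiskerRight, hy,
      braidedFactorial_succ V n]
    simp

lemma powMul_cons (V : C) (m n : ℕ) :
    (α_ (pow V m) V (pow V n)).hom ≫ pow V m ◁ powCons V n ≫ (powMul V m (n + 1)).hom =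
      (powMul V (m + 1) n).hom ≫ eqToHom (congrArg (pow V) (Nat.add_right_comm m 1 n)) := by
  induction n with
  | zero =>
    change (α_ (pow V m) V (𝟙_ C)).hom ≫ pow V m ◁ ((ρ_ V).hom ≫ (λ_ V).inv) ≫
      ((α_ (pow V m) (𝟙_ C) V).inv ≫ (ρ_ (pow V m)).hom ▷ V) =
      (ρ_ (pow V m ⊗ V)).hom ≫ 𝟙 _
    simp
  | succ n ih =>
    rw [eqToHom_pow_succ V (Nat.add_right_comm m 1 n)]
    change (α_ (pow V m) V (pow V n ⊗ V)).hom ≫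
        pow V m ◁ ((α_ V (pow V n) V).inv ≫ powCons V n ▷ V) ≫
        ((α_ (pow V m) (pow V (n + 1)) V).inv ≫ (powMul V m (n + 1)).hom ▷ V) =
      ((α_ (pow V m ⊗ V) (pow V n) V).inv ≫ (powMul V (m + 1) n).hom ▷ V) ≫ _
    rw [Category.assoc, ← comp_whiskerRight, ← ih]
    simp

lemma powMul_braidedFactorial_left (V : C) (m n : ℕ) :
    ∃ y : pow V m ⊗ pow V n ⟶ pow V (m + n),
      (powMul V m n).hom ≫ braidedFactorial V (m + n) = pow V m ◁ braidedFactorial V n ≫ y := by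
  induction m generalizing n with
  | zero =>
    refine ⟨(powMul V 0 n).hom, ?_⟩
    have h := powMul_zero_left V n
    rw [← cancel_mono (eqToHom (congrArg (pow V) (Nat.zero_add n))), Category.assoc, Category.assoc,
      braidedFactorial_eqToHom V (Nat.zero_add n), h, reassoc_of% h]
    simp
  | succ m ih =>
    obtain ⟨y, hy⟩ := ih (n + 1)
    obtain ⟨x, hx⟩ := powCons_braidedFactorial V n
    refine ⟨(α_ (pow V m) V (pow V n)).hom ≫ pow V m ◁ x ≫ y ≫
      eqToHom (congrArg (pow V) (Nat.add_right_comm m 1 n)).symm, ?_⟩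
    rw [← cancel_mono (eqToHom (congrArg (pow V) (Nat.add_right_comm m 1 n))), Category.assoc,
      braidedFactorial_eqToHom V (Nat.add_right_comm m 1 n), ← Category.assoc, ← powMul_cons]
    simp only [Category.assoc, eqToHom_trans, eqToHom_refl, Category.comp_id]
    change _ ≫ _ ≫ (powMul V m (n + 1)).hom ≫ braidedFactorial V (m + (n + 1)) = _
    rw [hy, ← MonoidalCategory.whiskerLeft_comp_assoc, hx]
    simp

end Factorial

section Quotients

variable {C : Type u} [Category.{v} C] [Abelian C] [MonoidalCategory C] [MonoidalPreadditive C]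
  [∀ X : C, PreservesColimitsOfSize.{0, 0} (tensorLeft X)]
  [∀ X : C, PreservesColimitsOfSize.{0, 0} (tensorRight X)]

instance epi_whiskerLeft (X : C) {Y Z : C} (f : Y ⟶ Z) [Epi f] : Epi (X ◁ f) :=
  inferInstanceAs (Epi ((tensorLeft X).map f))

instance epi_whiskerRight {Y Z : C} (f : Y ⟶ Z) [Epi f] (X : C) : Epi (f ▷ X) :=
  inferInstanceAs (Epi ((tensorRight X).map f))

instance epi_tensorHom {X Y Z W : C} (f : X ⟶ Y) (g : Z ⟶ W) [Epi f] [Epi g] : Epi (f ⊗ₘ g) := by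
  rw [MonoidalCategory.tensorHom_def]; infer_instance

lemma exists_whiskerLeft_desc (X : C) {K Y Z : C} (κ : K ⟶ Y) (f : X ⊗ Y ⟶ Z)
    (hf : X ◁ κ ≫ f = 0) : ∃ g : X ⊗ cokernel κ ⟶ Z, X ◁ cokernel.π κ ≫ g = f := by
  let h := isColimitCoforkMapOfIsColimit' (tensorLeft X) (cokernel.condition κ)
    (cokernelIsCokernel κ)
  exact ⟨h.desc (CokernelCofork.ofπ f hf), h.fac (CokernelCofork.ofπ f hf) WalkingParallelPair.one⟩

lemma exists_whiskerRight_desc (X : C) {K Y Z : C} (κ : K ⟶ Y) (f : Y ⊗ X ⟶ Z)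
    (hf : κ ▷ X ≫ f = 0) : ∃ g : cokernel κ ⊗ X ⟶ Z, cokernel.π κ ▷ X ≫ g = f := by
  let h := isColimitCoforkMapOfIsColimit' (tensorRight X) (cokernel.condition κ)
    (cokernelIsCokernel κ)
  exact ⟨h.desc (CokernelCofork.ofπ f hf), h.fac (CokernelCofork.ofπ f hf) WalkingParallelPair.one⟩

lemma exists_tensor_desc {K L Y Y' Z : C} (κ : K ⟶ Y) (l : L ⟶ Y') (f : Y ⊗ Y' ⟶ Z)
    (h₁ : κ ▷ Y' ≫ f = 0) (h₂ : Y ◁ l ≫ f = 0) :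
    ∃ g : cokernel κ ⊗ cokernel l ⟶ Z, (cokernel.π κ ⊗ₘ cokernel.π l) ≫ g = f := by
  obtain ⟨g, hg⟩ := exists_whiskerLeft_desc Y l f h₂
  obtain ⟨g', hg'⟩ := exists_whiskerRight_desc (cokernel l) κ g (by
    rw [← cancel_epi (K ◁ cokernel.π l), whisker_exchange_assoc, hg, h₁, comp_zero])
  refine ⟨g', ?_⟩
  rw [MonoidalCategory.tensorHom_def', Category.assoc, hg', hg]

/-- A two-sided graded ideal of `T`: morphisms `κ n` into `T_n` whose images are stable under left
and right multiplication by `T`. -/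
structure GradedIdeal (T : GradedMon C ℕ) where
  K : ℕ → C
  κ : ∀ n, K n ⟶ T.X n
  left : ∀ {i j k : ℕ} (h : i + j = k), T.X i ◁ κ j ≫ T.mul h ≫ cokernel.π (κ k) = 0
  right : ∀ {i j k : ℕ} (h : i + j = k), κ i ▷ T.X j ≫ T.mul h ≫ cokernel.π (κ k) = 0

variable {T : GradedMon C ℕ} (I : GradedIdeal T)

/-- The projection onto the quotient by a graded ideal. -/
noncomputable def GradedIdeal.π (n : ℕ) : T.X n ⟶ cokernel (I.κ n) := cokernel.π (I.κ n)

instance (n : ℕ) : Epi (I.π n) := inferInstanceAs (Epi (cokernel.π (I.κ n)))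

/-- The product on the quotient; it is determined by `GradedIdeal.π_quotMul`. -/
noncomputable def GradedIdeal.quotMul {i j k : ℕ} (h : i + j = k) :
    cokernel (I.κ i) ⊗ cokernel (I.κ j) ⟶ cokernel (I.κ k) :=
  (exists_tensor_desc (I.κ i) (I.κ j) (T.mul h ≫ I.π k) (I.right h) (I.left h)).choose

lemma GradedIdeal.π_quotMul {i j k : ℕ} (h : i + j = k) :
    (I.π i ⊗ₘ I.π j) ≫ I.quotMul h = T.mul h ≫ I.π k :=
  (exists_tensor_desc (I.κ i) (I.κ j) (T.mul h ≫ I.π k) (I.right h) (I.left h)).choose_spec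

lemma GradedIdeal.π_quotMul_left {i j k : ℕ} (h : i + j = k) :
    I.π i ▷ T.X j ≫ cokernel (I.κ i) ◁ I.π j ≫ I.quotMul h = T.mul h ≫ I.π k := by
  rw [← MonoidalCategory.tensorHom_def_assoc, I.π_quotMul]

/-- The quotient of a graded monoid by a two-sided graded ideal. -/
noncomputable def GradedIdeal.quotient : GradedMon C ℕ where
  X n := cokernel (I.κ n)
  one := T.one ≫ I.π 0
  mul h := I.quotMul h
  one_mul i := by
    rw [← cancel_epi (𝟙_ C ◁ I.π i), comp_whiskerRight, Category.assoc,
      whisker_exchange_assoc, whisker_exchange_assoc, I.π_quotMul_left, T.one_mul_assoc]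
    simp
  mul_one i := by
    rw [← cancel_epi (I.π i ▷ 𝟙_ C), MonoidalCategory.whiskerLeft_comp, Category.assoc,
      ← whisker_exchange_assoc, I.π_quotMul_left, T.mul_one_assoc]
    simp
  mul_assoc {i j k ij jk ijk} h₁ h₂ h₃ h₄ := by
    rw [← cancel_epi ((I.π i ⊗ₘ I.π j) ⊗ₘ I.π k), associator_naturality_assoc]
    simp only [tensorHom_comp_whiskerRight_assoc, tensorHom_comp_whiskerLeft_assoc, I.π_quotMul]
    rw [← whiskerRight_comp_tensorHom_assoc, ← whiskerLeft_comp_tensorHom_assoc,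
      I.π_quotMul, I.π_quotMul, T.mul_assoc_assoc h₁ h₂ h₃ h₄]

end Quotients

section Algebras

variable {C : Type u} [Category.{v} C] [Abelian C] [MonoidalCategory C] [MonoidalPreadditive C]
  [HasCountableCoproducts C]
  [∀ X : C, PreservesColimitsOfSize.{0, 0} (tensorLeft X)]
  [∀ X : C, PreservesColimitsOfSize.{0, 0} (tensorRight X)]

/-- The ideal `⨁ₙ ker [n, Ψ]!` of the tensor algebra. -/
noncomputable def factorialIdeal [BraidedCategory C] (V : C) : GradedIdeal (tensorAlgebra V) where
  K n := kernel (braidedFactorial V n)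
  κ n := kernel.ι (braidedFactorial V n)
  left {i j k} h := by
    subst h
    obtain ⟨y, hy⟩ := powMul_braidedFactorial_left V i j
    have hz : (pow V i ◁ kernel.ι (braidedFactorial V j) ≫ (powMul V i j).hom) ≫
        braidedFactorial V (i + j) = 0 := by
      rw [Category.assoc, hy, ← MonoidalCategory.whiskerLeft_comp_assoc, kernel.condition]
      simp
    rw [← Category.assoc]
    simp only [tensorAlgebra, eqToHom_refl, Category.comp_id]
    rw [← kernel.lift_ι _ _ hz, Category.assoc, cokernel.condition, comp_zero]
  right {i j k} h := by
    subst h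
    obtain ⟨y, hy⟩ := powMul_braidedFactorial_right V i j
    have hz : (kernel.ι (braidedFactorial V i) ▷ pow V j ≫ (powMul V i j).hom) ≫
        braidedFactorial V (i + j) = 0 := by
      rw [Category.assoc, hy, ← comp_whiskerRight_assoc, kernel.condition]
      simp
    rw [← Category.assoc]
    simp only [tensorAlgebra, eqToHom_refl, Category.comp_id]
    rw [← kernel.lift_ι _ _ hz, Category.assoc, cokernel.condition, comp_zero]

section Generated

variable (T : GradedMon C ℕ) {d : ℕ} {R : C} (r : R ⟶ T.X d)

/-- The ways to place a relation of degree `d` inside degree `n`. -/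
@[ext]
structure Position (d n : ℕ) where
  left : ℕ
  right : ℕ
  eq : left + d + right = n

instance (d n : ℕ) : Countable (Position d n) :=
  Function.Injective.countable (f := fun a : Position d n => (a.left, a.right)) fun a b h => by
    simp only [Prod.mk.injEq] at h
    exact Position.ext h.1 h.2

/-- The relation `r` of degree `d` multiplied by `T_i` on the left and `T_j` on the right. -/
def relationAt {i j n : ℕ} (h : i + d + j = n) : (T.X i ⊗ R) ⊗ T.X j ⟶ T.X n :=
  (T.X i ◁ r ≫ T.mul rfl) ▷ T.X j ≫ T.mul h

lemma mul_relationAt {i j n l m : ℕ} (h : i + d + j = n) (h' : l + n = m)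
    (h'' : l + i + d + j = m) :
    T.X l ◁ relationAt T r h ≫ T.mul h' =
      (α_ (T.X l) (T.X i ⊗ R) (T.X j)).inv ≫ (α_ (T.X l) (T.X i) R).inv ▷ T.X j ≫
        (T.mul rfl ▷ R) ▷ T.X j ≫ relationAt T r h'' := by
  have h₁ : l + (i + d) = l + i + d := by omega
  have e1 : T.X l ◁ T.mul h ≫ T.mul h' = (α_ _ _ _).inv ≫ T.mul h₁ ▷ T.X j ≫ T.mul h'' := by
    rw [T.mul_assoc h₁ h'' h h', Iso.inv_hom_id_assoc]
  have e2 : T.X l ◁ T.mul (rfl : i + d = _) ≫ T.mul h₁ =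
      (α_ _ _ _).inv ≫ T.mul rfl ▷ T.X d ≫ T.mul rfl := by
    rw [T.mul_assoc rfl rfl rfl h₁, Iso.inv_hom_id_assoc]
  have e3 : T.X l ◁ (T.X i ◁ r ≫ T.mul rfl) ≫ T.mul h₁ =
      (α_ _ _ _).inv ≫ T.mul rfl ▷ R ≫ T.X (l + i) ◁ r ≫ T.mul rfl := by
    rw [MonoidalCategory.whiskerLeft_comp_assoc, e2, associator_inv_naturality_right_assoc,
      whisker_exchange_assoc]
  rw [relationAt, MonoidalCategory.whiskerLeft_comp_assoc, e1,
    associator_inv_naturality_middle_assoc, ← comp_whiskerRight_assoc, e3, relationAt]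
  simp only [comp_whiskerRight, Category.assoc]

lemma relationAt_mul {i j n l m : ℕ} (h : i + d + j = n) (h' : n + l = m)
    (h'' : i + d + (j + l) = m) :
    relationAt T r h ▷ T.X l ≫ T.mul h' =
      (α_ (T.X i ⊗ R) (T.X j) (T.X l)).hom ≫ (T.X i ⊗ R) ◁ T.mul rfl ≫ relationAt T r h'' := by
  rw [relationAt, comp_whiskerRight_assoc, T.mul_assoc h h' rfl h'',
    associator_naturality_left_assoc, ← whisker_exchange_assoc, relationAt]

/-- All the multiples in degree `n` of the relation `r`: the image is the degree `n` part of the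
two-sided ideal generated by the image of `r`, that is `∑ T_i · im r · T_j` over `i + d + j = n`. -/
noncomputable def relations (n : ℕ) :
    (∐ fun a : Position d n => (T.X a.left ⊗ R) ⊗ T.X a.right) ⟶ T.X n :=
  Sigma.desc fun a => relationAt T r a.eq

lemma relationAt_π {i j n : ℕ} (h : i + d + j = n) :
    relationAt T r h ≫ cokernel.π (relations T r n) = 0 := by
  have e : Sigma.ι (fun a : Position d n => (T.X a.left ⊗ R) ⊗ T.X a.right) ⟨i, j, h⟩ ≫
      relations T r n = relationAt T r h := by
    simp [relations]
  rw [← e, Category.assoc, cokernel.condition, comp_zero]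

lemma ι_relations {n : ℕ} (a : Position d n) :
    Sigma.ι (fun a : Position d n => (T.X a.left ⊗ R) ⊗ T.X a.right) a ≫ relations T r n =
      relationAt T r a.eq := by
  simp [relations]

/-- The two-sided ideal of `T` generated by the image of a morphism `r : R ⟶ T_d`. -/
noncomputable def generatedIdeal : GradedIdeal T where
  K n := ∐ fun a : Position d n => (T.X a.left ⊗ R) ⊗ T.X a.right
  κ n := relations T r n
  left {i j k} h := by
    let hc := isColimitOfHasCoproductOfPreservesColimit (tensorLeft (T.X i))
      (fun a : Position d j => (T.X a.left ⊗ R) ⊗ T.X a.right)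
    refine Cofan.IsColimit.hom_ext hc _ _ fun a => ?_
    change T.X i ◁ Sigma.ι _ a ≫ _ = _ ≫ 0
    rw [comp_zero, ← MonoidalCategory.whiskerLeft_comp_assoc, ι_relations,
      ← Category.assoc, mul_relationAt T r a.eq h (by have := a.eq; omega)]
    simp only [Category.assoc]
    rw [relationAt_π]
    simp
  right {i j k} h := by
    let hc := isColimitOfHasCoproductOfPreservesColimit (tensorRight (T.X j))
      (fun a : Position d i => (T.X a.left ⊗ R) ⊗ T.X a.right)
    refine Cofan.IsColimit.hom_ext hc _ _ fun a => ?_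
    change Sigma.ι _ a ▷ T.X j ≫ _ = _ ≫ 0
    rw [comp_zero, ← comp_whiskerRight_assoc, ι_relations,
      ← Category.assoc, relationAt_mul T r a.eq h (by have := a.eq; omega)]
    simp only [Category.assoc]
    rw [relationAt_π]
    simp

end Generated

section Total

lemma sigma_whiskerRight_hom_ext {X : ℕ → C} {Y Z : C} {f g : (∐ X) ⊗ Y ⟶ Z}
    (h : ∀ n, Sigma.ι X n ▷ Y ≫ f = Sigma.ι X n ▷ Y ≫ g) : f = g :=
  Cofan.IsColimit.hom_ext (isColimitOfHasCoproductOfPreservesColimit (tensorRight Y) X) _ _ h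

lemma sigma_whiskerLeft_hom_ext {X : ℕ → C} {Y Z : C} {f g : Y ⊗ (∐ X) ⟶ Z}
    (h : ∀ n, Y ◁ Sigma.ι X n ≫ f = Y ◁ Sigma.ι X n ≫ g) : f = g :=
  Cofan.IsColimit.hom_ext (isColimitOfHasCoproductOfPreservesColimit (tensorLeft Y) X) _ _ h

/-- The morphism out of `(⨁ X) ⊗ (⨁ Y)` with given components. -/
noncomputable def sigmaTensorDesc {X Y : ℕ → C} {Z : C} (f : ∀ m n, X m ⊗ Y n ⟶ Z) :
    (∐ X) ⊗ (∐ Y) ⟶ Z :=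
  Cofan.IsColimit.desc (isColimitOfHasCoproductOfPreservesColimit (tensorRight (∐ Y)) X) fun m =>
    Cofan.IsColimit.desc (isColimitOfHasCoproductOfPreservesColimit (tensorLeft (X m)) Y) (f m)

lemma ι_sigmaTensorDesc {X Y : ℕ → C} {Z : C} (f : ∀ m n, X m ⊗ Y n ⟶ Z) (m n : ℕ) :
    Sigma.ι X m ▷ Y n ≫ (∐ X) ◁ Sigma.ι Y n ≫ sigmaTensorDesc f = f m n := by
  have h₁ : Sigma.ι X m ▷ (∐ Y) ≫ sigmaTensorDesc f =
      Cofan.IsColimit.desc (isColimitOfHasCoproductOfPreservesColimit (tensorLeft (X m)) Y) (f m) :=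
    Cofan.IsColimit.fac (isColimitOfHasCoproductOfPreservesColimit (tensorRight (∐ Y)) X) _ m
  rw [← whisker_exchange_assoc, h₁]
  exact Cofan.IsColimit.fac (isColimitOfHasCoproductOfPreservesColimit (tensorLeft (X m)) Y) _ n

lemma ι_tensor_sigmaTensorDesc {X Y : ℕ → C} {Z : C} (f : ∀ m n, X m ⊗ Y n ⟶ Z) (m n : ℕ) :
    (Sigma.ι X m ⊗ₘ Sigma.ι Y n) ≫ sigmaTensorDesc f = f m n := by
  rw [MonoidalCategory.tensorHom_def, Category.assoc, ι_sigmaTensorDesc]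

lemma sigma_whisker_hom_ext {X : ℕ → C} {W Y Z : C} {f g : (W ⊗ (∐ X)) ⊗ Y ⟶ Z}
    (h : ∀ n, (W ◁ Sigma.ι X n) ▷ Y ≫ f = (W ◁ Sigma.ι X n) ▷ Y ≫ g) : f = g :=
  Cofan.IsColimit.hom_ext
    (isColimitOfHasCoproductOfPreservesColimit (tensorLeft W ⋙ tensorRight Y) X) _ _ h

lemma sigma_hom_ext₃ {X : ℕ → C} {Z : C} {f g : ((∐ X) ⊗ (∐ X)) ⊗ (∐ X) ⟶ Z}
    (h : ∀ l m n, ((Sigma.ι X l ⊗ₘ Sigma.ι X m) ⊗ₘ Sigma.ι X n) ≫ f =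
      ((Sigma.ι X l ⊗ₘ Sigma.ι X m) ⊗ₘ Sigma.ι X n) ≫ g) : f = g := by
  refine sigma_whiskerLeft_hom_ext fun n => sigma_whisker_hom_ext fun m => ?_
  rw [← cancel_epi (α_ _ _ _).inv]
  refine sigma_whiskerRight_hom_ext fun l => ?_
  rw [associator_inv_naturality_left_assoc, associator_inv_naturality_left_assoc,
    ← comp_whiskerRight_assoc, ← comp_whiskerRight_assoc, ← MonoidalCategory.tensorHom_def,
    ← MonoidalCategory.tensorHom_def_assoc, ← MonoidalCategory.tensorHom_def_assoc, h]

variable (T : GradedMon C ℕ)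

lemma mul_ι {i j k : ℕ} (h : i + j = k) : T.mul h ≫ Sigma.ι T.X k =
    T.mul (rfl : i + j = _) ≫ Sigma.ι T.X (i + j) := by
  subst h; rfl

/-- The total algebra `⨁ₙ T_n` of a graded monoid, as a monoid in `C`. -/
noncomputable def total : Mon C where
  X := ∐ T.X
  mon :=
    { one := T.one ≫ Sigma.ι T.X 0
      mul := sigmaTensorDesc fun m n => T.mul (rfl : m + n = _) ≫ Sigma.ι T.X (m + n)
      one_mul := by
        refine sigma_whiskerLeft_hom_ext fun n => ?_
        rw [comp_whiskerRight, Category.assoc, whisker_exchange_assoc, whisker_exchange_assoc,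
          ι_sigmaTensorDesc, ← mul_ι T (zero_add n), T.one_mul_assoc]
        simp
      mul_one := by
        refine sigma_whiskerRight_hom_ext fun n => ?_
        rw [MonoidalCategory.whiskerLeft_comp, Category.assoc, ← whisker_exchange_assoc,
          ι_sigmaTensorDesc]
        exact (T.mul_one_assoc _ _).trans (rightUnitor_naturality (Sigma.ι T.X n)).symm
      mul_assoc := by
        refine sigma_hom_ext₃ fun l m n => ?_
        have h₁ := ι_tensor_sigmaTensorDesc
          (fun m n => T.mul (rfl : m + n = _) ≫ Sigma.ι T.X (m + n))
        rw [tensorHom_comp_whiskerRight_assoc, h₁, associator_naturality_assoc,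
          tensorHom_comp_whiskerLeft_assoc, h₁, ← whiskerRight_comp_tensorHom_assoc,
          ← whiskerLeft_comp_tensorHom_assoc, h₁, h₁,
          ← mul_ι T (add_assoc l m n).symm, T.mul_assoc_assoc rfl rfl rfl (add_assoc l m n).symm] }

end Total

end Algebras

section BraidedTensor

variable {C : Type u} [Category.{v} C] [MonoidalCategory C] [BraidedCategory C]

lemma tensorμ_mul_assoc {X₁ X₂ Y₁ Y₂ Z₁ Z₂ XY₁ XY₂ YZ₁ YZ₂ W₁ W₂ : C}
    (a₁ : X₁ ⊗ Y₁ ⟶ XY₁) (a₂ : X₂ ⊗ Y₂ ⟶ XY₂) (b₁ : XY₁ ⊗ Z₁ ⟶ W₁) (b₂ : XY₂ ⊗ Z₂ ⟶ W₂)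
    (c₁ : Y₁ ⊗ Z₁ ⟶ YZ₁) (c₂ : Y₂ ⊗ Z₂ ⟶ YZ₂) (d₁ : X₁ ⊗ YZ₁ ⟶ W₁) (d₂ : X₂ ⊗ YZ₂ ⟶ W₂)
    (h₁ : a₁ ▷ Z₁ ≫ b₁ = (α_ _ _ _).hom ≫ X₁ ◁ c₁ ≫ d₁)
    (h₂ : a₂ ▷ Z₂ ≫ b₂ = (α_ _ _ _).hom ≫ X₂ ◁ c₂ ≫ d₂) :
    (tensorμ X₁ X₂ Y₁ Y₂ ≫ (a₁ ⊗ₘ a₂)) ▷ (Z₁ ⊗ Z₂) ≫ tensorμ XY₁ XY₂ Z₁ Z₂ ≫ (b₁ ⊗ₘ b₂) =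
      (α_ _ _ _).hom ≫ (X₁ ⊗ X₂) ◁ (tensorμ Y₁ Y₂ Z₁ Z₂ ≫ (c₁ ⊗ₘ c₂)) ≫
        tensorμ X₁ X₂ YZ₁ YZ₂ ≫ (d₁ ⊗ₘ d₂) := by
  simp only [comp_whiskerRight, MonoidalCategory.whiskerLeft_comp, Category.assoc]
  rw [tensorμ_natural_left_assoc, tensorμ_natural_right_assoc, tensorHom_comp_tensorHom,
    tensorHom_comp_tensorHom, h₁, h₂, ← tensorHom_comp_tensorHom, tensor_associativity_assoc]

lemma tensorμ_one_mul {X₁ X₂ E₁ E₂ : C} (e₁ : 𝟙_ C ⟶ E₁) (e₂ : 𝟙_ C ⟶ E₂)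
    (a₁ : E₁ ⊗ X₁ ⟶ X₁) (a₂ : E₂ ⊗ X₂ ⟶ X₂)
    (h₁ : e₁ ▷ X₁ ≫ a₁ = (λ_ X₁).hom) (h₂ : e₂ ▷ X₂ ≫ a₂ = (λ_ X₂).hom) :
    ((λ_ (𝟙_ C)).inv ≫ (e₁ ⊗ₘ e₂)) ▷ (X₁ ⊗ X₂) ≫ tensorμ E₁ E₂ X₁ X₂ ≫ (a₁ ⊗ₘ a₂) =
      (λ_ (X₁ ⊗ X₂)).hom := by
  rw [comp_whiskerRight, Category.assoc, tensorμ_natural_left_assoc, tensorHom_comp_tensorHom,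
    h₁, h₂, tensor_left_unitality]

lemma tensorμ_mul_one {X₁ X₂ E₁ E₂ : C} (e₁ : 𝟙_ C ⟶ E₁) (e₂ : 𝟙_ C ⟶ E₂)
    (a₁ : X₁ ⊗ E₁ ⟶ X₁) (a₂ : X₂ ⊗ E₂ ⟶ X₂)
    (h₁ : X₁ ◁ e₁ ≫ a₁ = (ρ_ X₁).hom) (h₂ : X₂ ◁ e₂ ≫ a₂ = (ρ_ X₂).hom) :
    (X₁ ⊗ X₂) ◁ ((λ_ (𝟙_ C)).inv ≫ (e₁ ⊗ₘ e₂)) ≫ tensorμ X₁ X₂ E₁ E₂ ≫ (a₁ ⊗ₘ a₂) =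
      (ρ_ (X₁ ⊗ X₂)).hom := by
  rw [MonoidalCategory.whiskerLeft_comp, Category.assoc, tensorμ_natural_right_assoc,
    tensorHom_comp_tensorHom, h₁, h₂, tensor_right_unitality]

/-- The braided tensor product `M ⊗ A` of a graded monoid `M` with a monoid `A` put in degree `0`:
`(m ⊗ a)(m' ⊗ a') = m Ψ(a ⊗ m') a'`. -/
def GradedMon.tensorMon {J : Type} [AddMonoid J] (M : GradedMon C J) (A : Mon C) :
    GradedMon C J where
  X i := M.X i ⊗ A.X
  one := (λ_ (𝟙_ C)).inv ≫ (M.one ⊗ₘ (MonObj.one : 𝟙_ C ⟶ A.X))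
  mul {i j _} h := tensorμ (M.X i) A.X (M.X j) A.X ≫ (M.mul h ⊗ₘ (MonObj.mul : A.X ⊗ A.X ⟶ A.X))
  one_mul i := tensorμ_one_mul _ _ _ _ (M.one_mul i) (MonObj.one_mul A.X)
  mul_one i := tensorμ_mul_one _ _ _ _ (M.mul_one i) (MonObj.mul_one A.X)
  mul_assoc h₁ h₂ h₃ h₄ := tensorμ_mul_assoc _ _ _ _ _ _ _ _ (M.mul_assoc h₁ h₂ h₃ h₄)
    (MonObj.mul_assoc A.X)

variable [Preadditive C] [MonoidalPreadditive C]

/-- The braided super tensor product of two graded monoids, bigraded by `ℕ × ℕ`: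
`(m ⊗ n)(m' ⊗ n') = (-1)^{|n||m'|} m Ψ(n ⊗ m') n'`. -/
def GradedMon.superTensor (M N : GradedMon C ℕ) : GradedMon C (ℕ × ℕ) where
  X i := M.X i.1 ⊗ N.X i.2
  one := (λ_ (𝟙_ C)).inv ≫ (M.one ⊗ₘ N.one)
  mul {i j _} h := ((-1 : ℤ) ^ (i.2 * j.1)) •
    (tensorμ (M.X i.1) (N.X i.2) (M.X j.1) (N.X j.2) ≫
      (M.mul (congrArg Prod.fst h) ⊗ₘ N.mul (congrArg Prod.snd h)))
  one_mul i := by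
    simp only [Prod.snd_zero, zero_mul, pow_zero, one_smul]
    exact tensorμ_one_mul _ _ _ _ (M.one_mul i.1) (N.one_mul i.2)
  mul_one i := by
    simp only [Prod.fst_zero, mul_zero, pow_zero, one_smul]
    exact tensorμ_mul_one _ _ _ _ (M.mul_one i.1) (N.mul_one i.2)
  mul_assoc {i j k ij jk ijk} h₁ h₂ h₃ h₄ := by
    have h := tensorμ_mul_assoc _ _ _ _ _ _ _ _
      (M.mul_assoc (congrArg Prod.fst h₁) (congrArg Prod.fst h₂) (congrArg Prod.fst h₃)
        (congrArg Prod.fst h₄))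
      (N.mul_assoc (congrArg Prod.snd h₁) (congrArg Prod.snd h₂) (congrArg Prod.snd h₃)
        (congrArg Prod.snd h₄))
    have l : ∀ {X Y Z : C} (n : ℤ) (f : X ⟶ Y), Z ◁ (n • f) = n • (Z ◁ f) := fun n f =>
      (tensorLeft _).map_zsmul
    have r : ∀ {X Y Z : C} (n : ℤ) (f : X ⟶ Y), (n • f) ▷ Z = n • (f ▷ Z) := fun n f =>
      (tensorRight _).map_zsmul
    simp only [l, r, Preadditive.zsmul_comp, Preadditive.comp_zsmul, smul_smul, h]
    congr 1
    subst h₁ h₃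
    simp only [← pow_add, Prod.fst_add, Prod.snd_add]
    congr 1
    ring

end BraidedTensor

section Bimodules

variable {C : Type u} [Category.{v} C] [MonoidalCategory C]

/-- A monoid morphism from `A` to the degree zero part of the graded monoid `M`. -/
structure DegreeZeroHom {J : Type} [AddMonoid J] (A : Mon C) (M : GradedMon C J) where
  hom : A.X ⟶ M.X 0
  one_hom : MonObj.one ≫ hom = M.one
  mul_hom : MonObj.mul ≫ hom = (hom ⊗ₘ hom) ≫ M.mul (add_zero 0)

/-- The component `M_i` of a graded monoid as an `A`-bimodule, acting by multiplication in `M`. -/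
def component {J : Type} [AddMonoid J] {A : Mon C} {M : GradedMon C J} (φ : DegreeZeroHom A M) (i : J) :
    Bimod A A where
  X := M.X i
  actLeft := φ.hom ▷ M.X i ≫ M.mul (zero_add i)
  actRight := M.X i ◁ φ.hom ≫ M.mul (add_zero i)
  one_actLeft := by
    rw [← comp_whiskerRight_assoc, φ.one_hom, M.one_mul]
  actRight_one := by
    rw [← MonoidalCategory.whiskerLeft_comp_assoc, φ.one_hom, M.mul_one]
  left_assoc := by
    rw [← comp_whiskerRight_assoc, φ.mul_hom, comp_whiskerRight, Category.assoc,
      M.mul_assoc (add_zero 0) (zero_add i) (zero_add i) (zero_add i)]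
    rw [MonoidalCategory.whiskerLeft_comp, Category.assoc, whisker_exchange_assoc,
      whisker_exchange_assoc, ← associator_naturality_left_assoc]
    simp [MonoidalCategory.tensorHom_def]
  right_assoc := by
    rw [← MonoidalCategory.whiskerLeft_comp_assoc, φ.mul_hom, MonoidalCategory.whiskerLeft_comp,
      Category.assoc, comp_whiskerRight, Category.assoc, ← whisker_exchange_assoc,
      M.mul_assoc (add_zero i) (add_zero i) (add_zero 0) (add_zero i)]
    simp [MonoidalCategory.tensorHom_def]
  middle_assoc := by
    rw [comp_whiskerRight, Category.assoc, ← whisker_exchange_assoc,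
      M.mul_assoc (zero_add i) (add_zero i) (add_zero i) (zero_add i)]
    rw [MonoidalCategory.whiskerLeft_comp, Category.assoc, whisker_exchange_assoc,
      whisker_exchange_assoc, ← associator_naturality_left_assoc]
    simp

variable [BraidedCategory C]

lemma GradedMon.one_tensor_one_mul {J : Type} [AddMonoid J] (M : GradedMon C J) :
    (M.one ⊗ₘ M.one) ≫ M.mul (add_zero 0) = (λ_ (𝟙_ C)).hom ≫ M.one := by
  rw [MonoidalCategory.tensorHom_def', Category.assoc, M.one_mul, leftUnitor_naturality]

/-- The inclusion `a ↦ 1 ⊗ a` of `A` in `M ⊗ A`. -/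
def DegreeZeroHom.tensorMon {J : Type} [AddMonoid J] (M : GradedMon C J) (A : Mon C) :
    DegreeZeroHom A (M.tensorMon A) where
  hom := (λ_ A.X).inv ≫ M.one ▷ A.X
  one_hom := by
    simp [GradedMon.tensorMon, MonoidalCategory.tensorHom_def']
  mul_hom := by
    rw [← cancel_epi ((λ_ A.X).hom ⊗ₘ (λ_ A.X).hom)]
    simp only [GradedMon.tensorMon, tensorHom_comp_tensorHom_assoc, Iso.hom_inv_id_assoc,
      ← tensorHom_id]
    rw [tensorμ_natural_assoc, tensorHom_comp_tensorHom, M.one_tensor_one_mul,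
      leftUnitor_monoidal_assoc, leftUnitor_inv_naturality_assoc, Iso.hom_inv_id_assoc,
      id_tensorHom_id, Category.id_comp, tensorHom_id, whisker_exchange, ← comp_whiskerRight_assoc,
      ← MonoidalCategory.tensorHom_def]

/-- The morphism `a ↦ φ a ⊗ 1` to `M ⊗ N`. -/
def DegreeZeroHom.superTensor [Preadditive C] [MonoidalPreadditive C] {A : Mon C} {M : GradedMon C ℕ}
    (φ : DegreeZeroHom A M) (N : GradedMon C ℕ) : DegreeZeroHom A (M.superTensor N) where
  hom := φ.hom ≫ (ρ_ (M.X 0)).inv ≫ M.X 0 ◁ N.one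
  one_hom := by
    rw [← Category.assoc, φ.one_hom]
    simp [GradedMon.superTensor, MonoidalCategory.tensorHom_def, unitors_inv_equal]
  mul_hom := by
    have h : ((ρ_ (M.X 0)).inv ≫ M.X 0 ◁ N.one ⊗ₘ (ρ_ (M.X 0)).inv ≫ M.X 0 ◁ N.one) ≫
        tensorμ (M.X 0) (N.X 0) (M.X 0) (N.X 0) ≫ (M.mul (add_zero 0) ⊗ₘ N.mul (add_zero 0)) =
        M.mul (add_zero 0) ≫ (ρ_ (M.X 0)).inv ≫ M.X 0 ◁ N.one := by
      rw [← cancel_epi ((ρ_ (M.X 0)).hom ⊗ₘ (ρ_ (M.X 0)).hom)]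
      simp only [tensorHom_comp_tensorHom_assoc, Iso.hom_inv_id_assoc, ← id_tensorHom]
      rw [tensorμ_natural_assoc, tensorHom_comp_tensorHom, N.one_tensor_one_mul,
        rightUnitor_monoidal_assoc, id_tensorHom_id, Category.id_comp,
        id_tensorHom, rightUnitor_inv_naturality_assoc, Iso.hom_inv_id_assoc,
        ← whisker_exchange, ← MonoidalCategory.whiskerLeft_comp_assoc,
        ← MonoidalCategory.tensorHom_def']
    have h' : (M.superTensor N).mul (add_zero 0) =
        tensorμ (M.X 0) (N.X 0) (M.X 0) (N.X 0) ≫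
          (M.mul (add_zero 0) ⊗ₘ N.mul (add_zero 0)) := by
      simp [GradedMon.superTensor]
    have e : (MonObj.mul : A.X ⊗ A.X ⟶ A.X) ≫ φ.hom ≫ (ρ_ (M.X 0)).inv ≫ M.X 0 ◁ N.one =
        (φ.hom ≫ (ρ_ (M.X 0)).inv ≫ M.X 0 ◁ N.one ⊗ₘ φ.hom ≫ (ρ_ (M.X 0)).inv ≫ M.X 0 ◁ N.one) ≫
          tensorμ (M.X 0) (N.X 0) (M.X 0) (N.X 0) ≫
            (M.mul (add_zero 0) ⊗ₘ N.mul (add_zero 0)) := by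
      rw [← tensorHom_comp_tensorHom_assoc, h, ← Category.assoc, φ.mul_hom, Category.assoc]
    rw [h']
    exact e

end Bimodules

section Omega

variable {C : Type u} [Category.{v} C] [Abelian C] [MonoidalCategory C] [MonoidalPreadditive C]
  [BraidedCategory C] [HasCountableCoproducts C]
  [∀ X : C, PreservesColimitsOfSize.{0, 0} (tensorLeft X)]
  [∀ X : C, PreservesColimitsOfSize.{0, 0} (tensorRight X)]

/-- The braided symmetric (Nichols-Woronowicz) algebra `B = B₊(V) = TV / ⨁ₙ ker [n, Ψ]!`. -/
noncomputable def braidedSymmetric (V : C) : Mon C :=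
  total (factorialIdeal V).quotient

/-- The braided exterior algebra `Λ(V) = TV / ⟨im (id + Ψ)⟩`. -/
noncomputable def braidedExterior (V : C) : GradedMon C ℕ :=
  (generatedIdeal (tensorAlgebra V) (d := 2) (𝟙 (pow V 2) + braidLast V 0)).quotient

/-- `Ω^{•,0} = Λ ⊗ B`, the braided tensor product algebra. -/
noncomputable def holomorphicForms (V : C) : GradedMon C ℕ :=
  (braidedExterior V).tensorMon (braidedSymmetric V)

/-- The bigraded algebra `Ω = Λ ⊗ B ⊗ Λ`, the braided super tensor product. -/
noncomputable def formAlgebra (V : C) : GradedMon C (ℕ × ℕ) :=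
  (holomorphicForms V).superTensor (braidedExterior V)

/-- The algebra morphism `B ⟶ Ω^{0,0}`, `b ↦ 1 ⊗ b ⊗ 1`. -/
noncomputable def coordinateHom (V : C) : DegreeZeroHom (braidedSymmetric V) (formAlgebra V) :=
  (DegreeZeroHom.tensorMon (braidedExterior V) (braidedSymmetric V)).superTensor (braidedExterior V)

/-- The `B`-bimodule `Ω^{p,q} = Λ^p ⊗ B ⊗ Λ^q`; `B` acts by multiplication by `1 ⊗ b ⊗ 1`. -/
noncomputable def forms (V : C) (p q : ℕ) : Bimod (braidedSymmetric V) (braidedSymmetric V) :=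
  component (coordinateHom V) (p, q)

/-- The wedge product `Ω^{p,q} ⊗ Ω^{p',q'} ⟶ Ω^{r,s}`, where `(p, q) + (p', q') = (r, s)`. -/
noncomputable def wedge (V : C) {p q p' q' r s : ℕ} (h : (p, q) + (p', q') = (r, s)) :
    (forms V p q).X ⊗ (forms V p' q').X ⟶ (forms V r s).X :=
  (formAlgebra V).mul h

/-- The canonical projection `M ⊗ N ⟶ M ⊗_B N`. -/
noncomputable def projTensor {A : Mon C} (M N : Bimod A A) :
    M.X ⊗ N.X ⟶ (M.tensorBimod N).X :=
  coequalizer.π (M.actRight ▷ N.X) ((α_ M.X A.X N.X).hom ≫ M.X ◁ N.actLeft)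

/-- The identification `Λ^p ⊗ B ⟶ Ω^{p,0} = Λ^p ⊗ B ⊗ Λ^0`, `x ↦ x ⊗ 1`. -/
noncomputable def inHolomorphic (V : C) (p : ℕ) :
    (braidedExterior V).X p ⊗ (braidedSymmetric V).X ⟶ (forms V p 0).X :=
  (ρ_ ((braidedExterior V).X p ⊗ (braidedSymmetric V).X)).inv ≫
    ((braidedExterior V).X p ⊗ (braidedSymmetric V).X) ◁ (braidedExterior V).one

/-- The inclusion `Λ^q ⟶ Ω^{0,q} = Λ^0 ⊗ B ⊗ Λ^q`, `η ↦ 1 ⊗ 1 ⊗ η`. -/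
noncomputable def inAntiholomorphic (V : C) (q : ℕ) :
    (braidedExterior V).X q ⟶ (forms V 0 q).X :=
  (λ_ ((braidedExterior V).X q)).inv ≫ (holomorphicForms V).one ▷ (braidedExterior V).X q

/-- The map `λ ⊗ b ⊗ η ↦ (λ ⊗ b ⊗ 1) ⊗_B (1 ⊗ 1 ⊗ η)`. -/
noncomputable def splitHolAnti (V : C) (p q : ℕ) :
    (forms V p q).X ⟶ ((forms V p 0).tensorBimod (forms V 0 q)).X :=
  (inHolomorphic V p ⊗ₘ inAntiholomorphic V q) ≫ projTensor (forms V p 0) (forms V 0 q)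

/-- The inverse braiding `Ψ_{Λ^q, Λ^p ⊗ B}⁻¹ : Λ^p ⊗ B ⊗ Λ^q ⟶ Λ^q ⊗ Λ^p ⊗ B` with the sign
`(-1)^{pq}`, followed by `η ⊗ λ ⊗ b ↦ (1 ⊗ 1 ⊗ η) ⊗_B (λ ⊗ b ⊗ 1)`. -/
noncomputable def splitAntiHol (V : C) (p q : ℕ) :
    (forms V p q).X ⟶ ((forms V 0 q).tensorBimod (forms V p 0)).X :=
  ((-1 : ℤ) ^ (p * q)) •
    ((β_ ((braidedExterior V).X q) ((braidedExterior V).X p ⊗ (braidedSymmetric V).X)).inv ≫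
      (inAntiholomorphic V q ⊗ₘ inHolomorphic V p) ≫ projTensor (forms V 0 q) (forms V p 0))

/-- Factorisability of a bigraded algebra `M` over `A`: both
`∧ : M^{p,0} ⊗_A M^{0,q} ⟶ M^{p,q}` and `∧ : M^{0,q} ⊗_A M^{p,0} ⟶ M^{p,q}` are well defined
isomorphisms of `A`-bimodules, for all `p, q`. -/
def IsFactorisable {A : Mon C} {M : GradedMon C (ℕ × ℕ)} (φ : DegreeZeroHom A M) : Prop :=
  ∀ p q : ℕ,
    (∃ e : (component φ (p, 0)).tensorBimod (component φ (0, q)) ≅ component φ (p, q),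
      projTensor (component φ (p, 0)) (component φ (0, q)) ≫ e.hom.hom =
        M.mul (show (p, 0) + (0, q) = (p, q) by simp)) ∧
    (∃ e : (component φ (0, q)).tensorBimod (component φ (p, 0)) ≅ component φ (p, q),
      projTensor (component φ (0, q)) (component φ (p, 0)) ≫ e.hom.hom =
        M.mul (show (0, q) + (p, 0) = (p, q) by simp))

end Omega

end BraidedPlane

/-! Regard `Ω` as a super tensor product `M ⊗ N` with `M = Λ ⊗ B` and `N = Λ`. Only two facts about
these algebras enter: `N_0` is the unit object, because the relations of `Λ` start in degree 2, and
consequently `M_0 = Λ^0 ⊗ B` is `B` itself. Hence `M_p ≅ Ω^{p,0}` by `x ↦ x ⊗ 1`, and `N_q`,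
embedded by `η ↦ 1 ⊗ η`, generates `Ω^{0,q} = B ⊗ N_q` freely as a left `B`-module. Since `(1 ⊗ η) b
= Ψ(η ⊗ b)` and `Ψ` is invertible, `N_q` generates it freely as a right module too.

On these generators the wedge product is explicit: `(x ⊗ 1)(1 ⊗ η) = x ⊗ η`, with no sign or
braiding left, and `(1 ⊗ η)(x ⊗ 1) = (-1)^{pq} Ψ(η ⊗ x)` (`GradedMon.superInl_superInr_mul`,
`GradedMon.superInr_superInl_mul`). Both are invertible.

The rest is a general principle about modules over a monoid. By associativity the wedge product is
balanced and bilinear, so it descends to a bimodule map on `⊗_B`. Inverting it on generators and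
projecting to `⊗_B` gives a candidate inverse. One composite is the identity at once; the other is
an identity between balanced maps, which may be tested on generators of one factor
(`exists_iso_of_generators_right` for the first order of factors, `exists_iso_of_generators_left`
for the second). -/

namespace BraidedPlane

/-! ### Products between components of a graded monoid as bimodule pairings. -/

section ComponentProducts

variable {C : Type u} [Category.{v} C] [MonoidalCategory C] {J : Type} [AddMonoid J] {A : Mon C}
  {M : GradedMon C J} (φ : DegreeZeroHom A M)

/-- Both actions are multiplication by the image of `A`, so this lemma and the next two are
associativity in `M` with that image in the left, right and middle slot. Together they let the
product descend to `⊗_A` as a bimodule morphism. -/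
lemma component_actLeft_mul {i j k : J} (h : i + j = k) :
    (component φ i).actLeft ▷ M.X j ≫ M.mul h =
      (α_ A.X (M.X i) (M.X j)).hom ≫ A.X ◁ M.mul h ≫ (component φ k).actLeft := by
  simp only [component]
  rw [comp_whiskerRight, Category.assoc, M.mul_assoc (zero_add i) h h (zero_add k),
    whisker_exchange_assoc, ← associator_naturality_left_assoc]

lemma component_mul_actRight {i j k : J} (h : i + j = k) :
    M.X i ◁ (component φ j).actRight ≫ M.mul h =
      (α_ (M.X i) (M.X j) A.X).inv ≫ M.mul h ▷ A.X ≫ (component φ k).actRight := by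
  simp only [component]
  rw [← whisker_exchange_assoc, M.mul_assoc h (add_zero k) (add_zero j) h,
    ← associator_inv_naturality_right_assoc, Iso.inv_hom_id_assoc,
    MonoidalCategory.whiskerLeft_comp, Category.assoc]

lemma component_mul_balanced {i j k : J} (h : i + j = k) :
    (component φ i).actRight ▷ M.X j ≫ M.mul h =
      (α_ (M.X i) A.X (M.X j)).hom ≫ M.X i ◁ (component φ j).actLeft ≫ M.mul h := by
  simp only [component]
  rw [comp_whiskerRight, Category.assoc, M.mul_assoc (add_zero i) h (zero_add j) h,
    associator_naturality_middle_assoc, MonoidalCategory.whiskerLeft_comp, Category.assoc]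

end ComponentProducts

/-! ### Relative tensor products: recognising `P ⊗_A N` from a pairing and generators. -/

section TensorOverMonoid

variable {C : Type u} [Category.{v} C] [Abelian C] [MonoidalCategory C] [MonoidalPreadditive C]
  [BraidedCategory C] [HasCountableCoproducts C]
  [∀ X : C, PreservesColimitsOfSize.{0, 0} (tensorLeft X)]
  [∀ X : C, PreservesColimitsOfSize.{0, 0} (tensorRight X)]

instance epi_projTensor {A : Mon C} (M N : Bimod A A) : Epi (projTensor M N) :=
  inferInstanceAs (Epi (coequalizer.π _ _))

lemma projTensor_balanced {A : Mon C} (M N : Bimod A A) :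
    M.actRight ▷ N.X ≫ projTensor M N =
      (α_ M.X A.X N.X).hom ≫ M.X ◁ N.actLeft ≫ projTensor M N := by
  rw [← Category.assoc (α_ M.X A.X N.X).hom]
  exact coequalizer.condition _ _

lemma whiskerLeft_projTensor_actLeft {A : Mon C} (M N : Bimod A A) :
    A.X ◁ projTensor M N ≫ (M.tensorBimod N).actLeft =
      (α_ A.X M.X N.X).inv ≫ M.actLeft ▷ N.X ≫ projTensor M N :=
  Bimod.TensorBimod.whiskerLeft_π_actLeft M N

lemma projTensor_whiskerRight_actRight {A : Mon C} (M N : Bimod A A) :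
    projTensor M N ▷ A.X ≫ (M.tensorBimod N).actRight =
      (α_ M.X N.X A.X).hom ≫ M.X ◁ N.actRight ≫ projTensor M N :=
  Bimod.TensorBimod.π_tensor_id_actRight M N

/-- A balanced bimodule pairing `m : P ⊗ N ⟶ R` with a section that inverts it modulo `A` makes the
induced morphism `P ⊗_A N ⟶ R` an isomorphism of bimodules. -/
lemma exists_iso_of_section {A : Mon C} (P N R : Bimod A A) (m : P.X ⊗ N.X ⟶ R.X)
    (hl : P.actLeft ▷ N.X ≫ m = (α_ A.X P.X N.X).hom ≫ A.X ◁ m ≫ R.actLeft)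
    (hr : P.X ◁ N.actRight ≫ m = (α_ P.X N.X A.X).inv ≫ m ▷ A.X ≫ R.actRight)
    (hb : P.actRight ▷ N.X ≫ m = (α_ P.X A.X N.X).hom ≫ P.X ◁ N.actLeft ≫ m)
    (s : R.X ⟶ P.X ⊗ N.X) (hs : s ≫ m = 𝟙 _) (hs' : m ≫ s ≫ projTensor P N = projTensor P N) :
    ∃ e : P.tensorBimod N ≅ R,
      projTensor P N ≫ e.hom.hom = m ∧ e.inv.hom = s ≫ projTensor P N := by
  let d : (P.tensorBimod N).X ⟶ R.X := coequalizer.desc m (hb.trans (Category.assoc _ _ _).symm)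
  have hd : projTensor P N ≫ d = m := coequalizer.π_desc _ _
  let f : (P.tensorBimod N).X ≅ R.X :=
    { hom := d
      inv := s ≫ projTensor P N
      hom_inv_id := by
        -- The projection is epi, so the composite on `P ⊗_A N` is tested on `P ⊗ N`, where it is
        -- `hs'`.
        rw [← cancel_epi (projTensor P N), ← Category.assoc, hd, hs', Category.comp_id]
      inv_hom_id := by rw [Category.assoc, hd, hs] }
  refine ⟨Bimod.isoOfIso f ?_ ?_, hd, rfl⟩
  · change (P.tensorBimod N).actLeft ≫ d = A.X ◁ d ≫ R.actLeft
    -- Tensoring preserves epimorphisms, so linearity can be checked before passing to the quotient,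
    -- where it is `hl`; likewise with `hr` below.
    rw [← cancel_epi (A.X ◁ projTensor P N), ← MonoidalCategory.whiskerLeft_comp_assoc, hd,
      ← Category.assoc, whiskerLeft_projTensor_actLeft, Category.assoc, Category.assoc, hd, hl,
      Iso.inv_hom_id_assoc]
  · change (P.tensorBimod N).actRight ≫ d = d ▷ A.X ≫ R.actRight
    rw [← cancel_epi (projTensor P N ▷ A.X), ← comp_whiskerRight_assoc, hd, ← Category.assoc,
      projTensor_whiskerRight_actRight, Category.assoc, Category.assoc, hd, hr,
      Iso.hom_inv_id_assoc]

/-- Balanced morphisms out of `P ⊗ N` agree as soon as they agree on generators of the left module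
`N`. -/
lemma balanced_hom_ext_of_generators_right {A : Mon C} (P N : Bimod A A) {Q Z : C} (f : Q ⟶ N.X)
    [Epi (A.X ◁ f ≫ N.actLeft)] (w w' : P.X ⊗ N.X ⟶ Z)
    (hw : P.actRight ▷ N.X ≫ w = (α_ P.X A.X N.X).hom ≫ P.X ◁ N.actLeft ≫ w)
    (hw' : P.actRight ▷ N.X ≫ w' = (α_ P.X A.X N.X).hom ≫ P.X ◁ N.actLeft ≫ w')
    (h : P.X ◁ f ≫ w = P.X ◁ f ≫ w') : w = w' := by
  -- Balancedness gives `w(x, a f(q)) = w(x a, f(q))`, so on elements `a f(q)`, which cover `N`, the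
  -- map `w` is determined by its restriction to `P ⊗ Q`.
  have key : ∀ w : P.X ⊗ N.X ⟶ Z,
      P.actRight ▷ N.X ≫ w = (α_ P.X A.X N.X).hom ≫ P.X ◁ N.actLeft ≫ w →
      P.X ◁ (A.X ◁ f ≫ N.actLeft) ≫ w =
        (α_ P.X A.X Q).inv ≫ P.actRight ▷ Q ≫ P.X ◁ f ≫ w := by
    intro w hw
    rw [← whisker_exchange_assoc, hw, ← associator_inv_naturality_right_assoc,
      Iso.inv_hom_id_assoc, MonoidalCategory.whiskerLeft_comp, Category.assoc]
  rw [← cancel_epi (P.X ◁ (A.X ◁ f ≫ N.actLeft)), key w hw, key w' hw', h]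

/-- Balanced morphisms out of `P ⊗ N` agree as soon as they agree on generators of the right module
`P`. -/
lemma balanced_hom_ext_of_generators_left {A : Mon C} (P N : Bimod A A) {Q Z : C} (f : Q ⟶ P.X)
    [Epi (f ▷ A.X ≫ P.actRight)] (w w' : P.X ⊗ N.X ⟶ Z)
    (hw : P.actRight ▷ N.X ≫ w = (α_ P.X A.X N.X).hom ≫ P.X ◁ N.actLeft ≫ w)
    (hw' : P.actRight ▷ N.X ≫ w' = (α_ P.X A.X N.X).hom ≫ P.X ◁ N.actLeft ≫ w')
    (h : f ▷ N.X ≫ w = f ▷ N.X ≫ w') : w = w' := by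
  -- The mirror image: `w(f(q) a, y) = w(f(q), a y)`.
  have key : ∀ w : P.X ⊗ N.X ⟶ Z,
      P.actRight ▷ N.X ≫ w = (α_ P.X A.X N.X).hom ≫ P.X ◁ N.actLeft ≫ w →
      (f ▷ A.X ≫ P.actRight) ▷ N.X ≫ w =
        (α_ Q A.X N.X).hom ≫ Q ◁ N.actLeft ≫ f ▷ N.X ≫ w := by
    intro w hw
    rw [whisker_exchange_assoc, ← associator_naturality_left_assoc, comp_whiskerRight,
      Category.assoc, hw]
  rw [← cancel_epi ((f ▷ A.X ≫ P.actRight) ▷ N.X), key w hw, key w' hw', h]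

/-- A balanced bimodule pairing `P ⊗ N ⟶ R` that is inverted by `t` on `E ⊗ Q`, where `E` covers
`P` and `Q` generates the left module `N`, induces an isomorphism `P ⊗_A N ≅ R`. -/
lemma exists_iso_of_generators_right {A : Mon C} (P N R : Bimod A A) (m : P.X ⊗ N.X ⟶ R.X)
    (hl : P.actLeft ▷ N.X ≫ m = (α_ A.X P.X N.X).hom ≫ A.X ◁ m ≫ R.actLeft)
    (hr : P.X ◁ N.actRight ≫ m = (α_ P.X N.X A.X).inv ≫ m ▷ A.X ≫ R.actRight)
    (hb : P.actRight ▷ N.X ≫ m = (α_ P.X A.X N.X).hom ≫ P.X ◁ N.actLeft ≫ m)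
    {E Q : C} (e : E ⟶ P.X) (f : Q ⟶ N.X) (he : Epi e) (hf : Epi (A.X ◁ f ≫ N.actLeft))
    (t : R.X ⟶ E ⊗ Q) (ht : t ≫ (e ⊗ₘ f) ≫ m = 𝟙 _) (ht' : (e ⊗ₘ f) ≫ m ≫ t = 𝟙 _) :
    ∃ i : P.tensorBimod N ≅ R,
      projTensor P N ≫ i.hom.hom = m ∧ i.inv.hom = t ≫ (e ⊗ₘ f) ≫ projTensor P N := by
  rw [← Category.assoc t]
  refine exists_iso_of_section P N R m hl hr hb (t ≫ (e ⊗ₘ f)) (by rw [Category.assoc, ht]) ?_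
  refine balanced_hom_ext_of_generators_right P N f _ _ ?_ (projTensor_balanced P N) ?_
  -- The round trip starts with `m`, hence inherits its balancedness.
  · rw [← Category.assoc, hb]; simp only [Category.assoc]
  -- On `P ⊗ Q` the first factor is replaced by its cover `E`; there `ht'` says that `m` followed by
  -- `t` is the identity.
  · rw [← cancel_epi (e ▷ Q), ← MonoidalCategory.tensorHom_def_assoc,
      ← MonoidalCategory.tensorHom_def_assoc, Category.assoc, reassoc_of% ht']

/-- A balanced bimodule pairing `P ⊗ N ⟶ R` that is inverted by `t` on `Q ⊗ E`, where `Q` generates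
the right module `P` and `E` covers `N`, induces an isomorphism `P ⊗_A N ≅ R`. -/
lemma exists_iso_of_generators_left {A : Mon C} (P N R : Bimod A A) (m : P.X ⊗ N.X ⟶ R.X)
    (hl : P.actLeft ▷ N.X ≫ m = (α_ A.X P.X N.X).hom ≫ A.X ◁ m ≫ R.actLeft)
    (hr : P.X ◁ N.actRight ≫ m = (α_ P.X N.X A.X).inv ≫ m ▷ A.X ≫ R.actRight)
    (hb : P.actRight ▷ N.X ≫ m = (α_ P.X A.X N.X).hom ≫ P.X ◁ N.actLeft ≫ m)
    {E Q : C} (f : Q ⟶ P.X) (e : E ⟶ N.X) (he : Epi e) (hf : Epi (f ▷ A.X ≫ P.actRight))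
    (t : R.X ⟶ Q ⊗ E) (ht : t ≫ (f ⊗ₘ e) ≫ m = 𝟙 _) (ht' : (f ⊗ₘ e) ≫ m ≫ t = 𝟙 _) :
    ∃ i : P.tensorBimod N ≅ R,
      projTensor P N ≫ i.hom.hom = m ∧ i.inv.hom = t ≫ (f ⊗ₘ e) ≫ projTensor P N := by
  rw [← Category.assoc t]
  refine exists_iso_of_section P N R m hl hr hb (t ≫ (f ⊗ₘ e)) (by rw [Category.assoc, ht]) ?_
  refine balanced_hom_ext_of_generators_left P N f _ _ ?_ (projTensor_balanced P N) ?_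
  · rw [← Category.assoc, hb]; simp only [Category.assoc]
  · rw [← cancel_epi (Q ◁ e), ← MonoidalCategory.tensorHom_def'_assoc,
      ← MonoidalCategory.tensorHom_def'_assoc, Category.assoc, reassoc_of% ht']

end TensorOverMonoid

/-! ### Products with units in a braided tensor product. -/

section BraidedProducts

variable {C : Type u} [Category.{v} C] [MonoidalCategory C] [BraidedCategory C]

/-- The only braiding in `tensorμ` here is that of the unit object with itself, which is a composite
of unitors; coherence does the rest. -/
lemma tensorμ_unit_middle (X Y : C) :
    ((ρ_ X).inv ⊗ₘ (λ_ Y).inv) ≫ tensorμ X (𝟙_ C) (𝟙_ C) Y ≫ ((ρ_ X).hom ⊗ₘ (λ_ Y).hom) =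
      𝟙 (X ⊗ Y) := by
  simp only [tensorμ, braiding_tensorUnit_left, MonoidalCategory.whiskerLeft_comp,
    comp_whiskerRight, Category.assoc]
  monoidal

/-- The units now sit on the outside, so the inner braiding of `Y` past `X` survives while
everything else is coherence. -/
lemma tensorμ_unit_outer (X Y : C) :
    ((λ_ Y).inv ⊗ₘ (ρ_ X).inv) ≫ tensorμ (𝟙_ C) Y X (𝟙_ C) ≫ ((λ_ X).hom ⊗ₘ (ρ_ Y).hom) =
      (β_ Y X).hom := by
  simp only [tensorμ, Category.assoc]
  monoidal

/-- This is `(x ⊗ 1)(1 ⊗ y) = x ⊗ y`: naturality pulls the units `e` and `f` through the braiding,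
where unitality absorbs them. -/
lemma tensorμ_mul_one_one_mul {X Y E F : C} (e : 𝟙_ C ⟶ E) (f : 𝟙_ C ⟶ F)
    (a : X ⊗ F ⟶ X) (b : E ⊗ Y ⟶ Y) (ha : X ◁ f ≫ a = (ρ_ X).hom) (hb : e ▷ Y ≫ b = (λ_ Y).hom) :
    ((ρ_ X).inv ≫ X ◁ e ⊗ₘ (λ_ Y).inv ≫ f ▷ Y) ≫ tensorμ X E F Y ≫ (a ⊗ₘ b) = 𝟙 (X ⊗ Y) := by
  rw [← tensorHom_comp_tensorHom, Category.assoc, ← id_tensorHom, ← tensorHom_id,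
    tensorμ_natural_assoc, tensorHom_comp_tensorHom, id_tensorHom, tensorHom_id, ha, hb,
    tensorμ_unit_middle]

/-- This is `(1 ⊗ y)(x ⊗ 1) = Ψ(y ⊗ x)`, by the same naturality argument. -/
lemma tensorμ_one_mul_mul_one {X Y E F : C} (e : 𝟙_ C ⟶ E) (f : 𝟙_ C ⟶ F)
    (a : F ⊗ X ⟶ X) (b : Y ⊗ E ⟶ Y) (ha : f ▷ X ≫ a = (λ_ X).hom) (hb : Y ◁ e ≫ b = (ρ_ Y).hom) :
    ((λ_ Y).inv ≫ f ▷ Y ⊗ₘ (ρ_ X).inv ≫ X ◁ e) ≫ tensorμ F Y X E ≫ (a ⊗ₘ b) = (β_ Y X).hom := by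
  rw [← tensorHom_comp_tensorHom, Category.assoc, ← id_tensorHom, ← tensorHom_id,
    tensorμ_natural_assoc, tensorHom_comp_tensorHom, id_tensorHom, tensorHom_id, ha, hb,
    tensorμ_unit_outer]

end BraidedProducts

/-! ### The degree zero part of the braided exterior algebra. -/

section Unit

variable {C : Type u} [Category.{v} C] [Abelian C] [MonoidalCategory C] [MonoidalPreadditive C]
  [BraidedCategory C] [HasCountableCoproducts C]
  [∀ X : C, PreservesColimitsOfSize.{0, 0} (tensorLeft X)]
  [∀ X : C, PreservesColimitsOfSize.{0, 0} (tensorRight X)]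

lemma relations_eq_zero_of_lt (T : GradedMon C ℕ) {d : ℕ} {R : C} (r : R ⟶ T.X d) {n : ℕ}
    (h : n < d) : relations T r n = 0 :=
  -- No position exists: `left + d + right = n` is impossible when `n < d`.
  Sigma.hom_ext _ _ fun a => absurd a.eq (by omega)

/-- The relations have degree 2, so nothing is divided out in degree 0, and the unit of `TV` is
already the identity of `𝟙_ C`. -/
instance isIso_braidedExterior_one (V : C) : IsIso (braidedExterior V).one := by
  let r : pow V 2 ⟶ (tensorAlgebra V).X 2 := 𝟙 (pow V 2) + braidLast V 0
  have h : relations (tensorAlgebra V) r 0 = 0 := relations_eq_zero_of_lt _ _ (by norm_num)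
  have hm : IsIso (cokernel.π (relations (tensorAlgebra V) r 0)) := by
    rw [h]; exact cokernel.π_zero_isIso
  have : IsIso (𝟙 (𝟙_ C) ≫ cokernel.π (relations (tensorAlgebra V) r 0)) := inferInstance
  exact this

end Unit

/-! ### The two embedded factors of a super tensor product and their products. -/

section SuperTensor

variable {C : Type u} [Category.{v} C] [MonoidalCategory C] [BraidedCategory C] [Preadditive C]
  [MonoidalPreadditive C] (M N : GradedMon C ℕ)

/-- The inclusion `x ↦ x ⊗ 1` of `M` in the super tensor product of `M` and `N`. -/
def GradedMon.superInl (p : ℕ) : M.X p ⟶ (M.superTensor N).X (p, 0) :=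
  (ρ_ (M.X p)).inv ≫ M.X p ◁ N.one

/-- The inclusion `y ↦ 1 ⊗ y` of `N` in the super tensor product of `M` and `N`. -/
def GradedMon.superInr (q : ℕ) : N.X q ⟶ (M.superTensor N).X (0, q) :=
  (λ_ (N.X q)).inv ≫ M.one ▷ N.X q

lemma GradedMon.superInl_superInr_mul (p q : ℕ) (h : ((p, 0) : ℕ × ℕ) + (0, q) = (p, q)) :
    (M.superInl N p ⊗ₘ M.superInr N q) ≫ (M.superTensor N).mul h = 𝟙 (M.X p ⊗ N.X q) := by
  -- The two middle degrees are both zero, so the sign is trivial.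
  have e : (M.superTensor N).mul h = tensorμ (M.X p) (N.X 0) (M.X 0) (N.X q) ≫
      (M.mul (add_zero p) ⊗ₘ N.mul (zero_add q)) := by
    simp [GradedMon.superTensor]
  rw [e]
  exact tensorμ_mul_one_one_mul _ _ _ _ (M.mul_one p) (N.one_mul q)

lemma GradedMon.superInr_superInl_mul (p q : ℕ) (h : ((0, q) : ℕ × ℕ) + (p, 0) = (p, q)) :
    (M.superInr N q ⊗ₘ M.superInl N p) ≫ (M.superTensor N).mul h =
      ((-1 : ℤ) ^ (p * q)) • (β_ (N.X q) (M.X p)).hom := by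
  -- The middle degrees are now `q` and `p`, which is where the sign comes from.
  have e : (M.superTensor N).mul h = ((-1 : ℤ) ^ (p * q)) •
      (tensorμ (M.X 0) (N.X q) (M.X p) (N.X 0) ≫
        (M.mul (zero_add p) ⊗ₘ N.mul (add_zero q))) := by
    simp [GradedMon.superTensor, mul_comm]
  rw [e]
  refine (Preadditive.comp_zsmul _ _ _).trans ?_
  exact congrArg _ (tensorμ_one_mul_mul_one _ _ _ _ (M.one_mul p) (N.mul_one q))

variable {A : Mon C} {M} (φ : DegreeZeroHom A M)

/-- The action map restricted to generators. When `φ.hom` is invertible it is an isomorphism, so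
`N_q` generates the left module. -/
lemma superInr_actLeft (q : ℕ) :
    A.X ◁ M.superInr N q ≫ (component (φ.superTensor N) (0, q)).actLeft = φ.hom ▷ N.X q := by
  -- `A` acts through `φ` followed by `M.superInl N 0`, so the product of the two embeddings applies
  -- with `p = 0`.
  change A.X ◁ M.superInr N q ≫ (φ.hom ≫ M.superInl N 0) ▷ _ ≫ (M.superTensor N).mul _ = _
  rw [whisker_exchange_assoc, comp_whiskerRight, Category.assoc,
    ← MonoidalCategory.tensorHom_def_assoc, M.superInl_superInr_mul]
  exact Category.comp_id _

/-- The right-handed counterpart: scalars are braided past `N_q`, without sign because they have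
degree zero. Invertibility of the braiding makes `N_q` generate the right module too. -/
lemma superInr_actRight (q : ℕ) :
    M.superInr N q ▷ A.X ≫ (component (φ.superTensor N) (0, q)).actRight =
      N.X q ◁ φ.hom ≫ (β_ (N.X q) (M.X 0)).hom := by
  change M.superInr N q ▷ A.X ≫ _ ◁ (φ.hom ≫ M.superInl N 0) ≫ (M.superTensor N).mul _ = _
  rw [← whisker_exchange_assoc, MonoidalCategory.whiskerLeft_comp, Category.assoc,
    ← MonoidalCategory.tensorHom_def'_assoc, M.superInr_superInl_mul, zero_mul, pow_zero, one_smul]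
  rfl

end SuperTensor

/-! ### Factorisation of a super tensor product over its degree zero part. -/

section Factorisation

variable {C : Type u} [Category.{v} C] [Abelian C] [MonoidalCategory C] [MonoidalPreadditive C]
  [BraidedCategory C] [HasCountableCoproducts C]
  [∀ X : C, PreservesColimitsOfSize.{0, 0} (tensorLeft X)]
  [∀ X : C, PreservesColimitsOfSize.{0, 0} (tensorRight X)] {A : Mon C} {M : GradedMon C ℕ}
  (φ : DegreeZeroHom A M) (N : GradedMon C ℕ) [IsIso N.one] [IsIso φ.hom]

instance isIso_superInl (p : ℕ) : IsIso (M.superInl N p) :=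
  inferInstanceAs (IsIso ((ρ_ (M.X p)).inv ≫ M.X p ◁ N.one))

/-- For `N_0 = 1` and `M_0 = A`, the super tensor product `M ⊗ N` satisfies
`M_p ⊗ N_q = (M_p ⊗ 1) ⊗_A (A ⊗ N_q)`. -/
lemma exists_superTensor_iso (p q : ℕ) (h : ((p, 0) : ℕ × ℕ) + (0, q) = (p, q)) :
    ∃ e : (component (φ.superTensor N) (p, 0)).tensorBimod (component (φ.superTensor N) (0, q)) ≅
        component (φ.superTensor N) (p, q),
      projTensor _ _ ≫ e.hom.hom = (M.superTensor N).mul h ∧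
      e.inv.hom = (M.superInl N p ⊗ₘ M.superInr N q) ≫
        projTensor (component (φ.superTensor N) (p, 0)) (component (φ.superTensor N) (0, q)) := by
  have hm := M.superInl_superInr_mul N p q h
  have hg : Epi (A.X ◁ M.superInr N q ≫ (component (φ.superTensor N) (0, q)).actLeft) :=
    (congrArg Epi (superInr_actLeft N φ q)).mpr (inferInstanceAs (Epi (φ.hom ▷ N.X q)))
  obtain ⟨e, he, he'⟩ := exists_iso_of_generators_right (component (φ.superTensor N) (p, 0))
    (component (φ.superTensor N) (0, q)) (component (φ.superTensor N) (p, q))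
    ((M.superTensor N).mul h) (component_actLeft_mul (φ.superTensor N) h) (component_mul_actRight (φ.superTensor N) h)
    (component_mul_balanced (φ.superTensor N) h) (M.superInl N p) (M.superInr N q)
    -- The product is the identity on `M_p ⊗ N_q`, so the identity is its inverse there.
    (inferInstanceAs (Epi (M.superInl N p))) hg (𝟙 (M.X p ⊗ N.X q))
    ((Category.id_comp _).trans hm)
    ((congrArg (fun g => (M.superInl N p ⊗ₘ M.superInr N q) ≫ g) (Category.comp_id _)).trans hm)
  exact ⟨e, he, he'.trans (Category.id_comp _)⟩

/-- For `N_0 = 1` and `M_0 = A`, the super tensor product `M ⊗ N` satisfies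
`M_p ⊗ N_q ≅ (A ⊗ N_q) ⊗_A (M_p ⊗ 1)`, by the inverse braiding with a sign. -/
lemma exists_superTensor_iso_swap (p q : ℕ) (h : ((0, q) : ℕ × ℕ) + (p, 0) = (p, q)) :
    ∃ e : (component (φ.superTensor N) (0, q)).tensorBimod (component (φ.superTensor N) (p, 0)) ≅
        component (φ.superTensor N) (p, q),
      projTensor _ _ ≫ e.hom.hom = (M.superTensor N).mul h ∧
      e.inv.hom = ((-1 : ℤ) ^ (p * q)) • ((β_ (N.X q) (M.X p)).inv ≫
        (M.superInr N q ⊗ₘ M.superInl N p) ≫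
        projTensor (component (φ.superTensor N) (0, q)) (component (φ.superTensor N) (p, 0))) := by
  have hm := M.superInr_superInl_mul N p q h
  have hg : Epi (M.superInr N q ▷ A.X ≫ (component (φ.superTensor N) (0, q)).actRight) :=
    (congrArg Epi (superInr_actRight N φ q)).mpr
      (inferInstanceAs (Epi (N.X q ◁ φ.hom ≫ (β_ (N.X q) (M.X 0)).hom)))
  have hsign : ((-1 : ℤ) ^ (p * q)) * (-1) ^ (p * q) = 1 := by
    rw [← mul_pow]; simp
  -- The inverse of the product on generators; the sign is its own inverse by `hsign`.
  let t : M.X p ⊗ N.X q ⟶ N.X q ⊗ M.X p := ((-1 : ℤ) ^ (p * q)) • (β_ (N.X q) (M.X p)).inv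
  have ht : t ≫ (((-1 : ℤ) ^ (p * q)) • (β_ (N.X q) (M.X p)).hom) = 𝟙 _ := by
    simp only [t, Preadditive.comp_zsmul, Preadditive.zsmul_comp, smul_smul, hsign, one_smul,
      Iso.inv_hom_id]
  have ht' : (((-1 : ℤ) ^ (p * q)) • (β_ (N.X q) (M.X p)).hom) ≫ t = 𝟙 _ := by
    simp only [t, Preadditive.comp_zsmul, Preadditive.zsmul_comp, smul_smul, hsign, one_smul,
      Iso.hom_inv_id]
  obtain ⟨e, he, he'⟩ := exists_iso_of_generators_left (component (φ.superTensor N) (0, q))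
    (component (φ.superTensor N) (p, 0)) (component (φ.superTensor N) (p, q))
    ((M.superTensor N).mul h) (component_actLeft_mul (φ.superTensor N) h) (component_mul_actRight (φ.superTensor N) h)
    (component_mul_balanced (φ.superTensor N) h) (M.superInr N q) (M.superInl N p)
    (inferInstanceAs (Epi (M.superInl N p))) hg t
    ((congrArg (fun g => t ≫ g) hm).trans ht)
    ((Category.assoc _ _ _).symm.trans ((congrArg (fun g => g ≫ t) hm).trans ht'))
  exact ⟨e, he, he'.trans (Preadditive.zsmul_comp _ _ _)⟩

/-- Supplies `M_0 = B` for `M = Λ ⊗ B`, from `Λ^0` being the unit object. -/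
instance isIso_tensorMon_hom (L : GradedMon C ℕ) (A : Mon C) [IsIso L.one] :
    IsIso (DegreeZeroHom.tensorMon L A).hom :=
  inferInstanceAs (IsIso ((λ_ A.X).inv ≫ L.one ▷ A.X))

end Factorisation

end BraidedPlane

open BraidedPlane in
theorem corollary3p2 {C : Type u} [Category.{v} C] [Abelian C] [MonoidalCategory C]
    [MonoidalPreadditive C] [BraidedCategory C] [HasCountableCoproducts C]
    [∀ X : C, PreservesColimitsOfSize.{0, 0} (tensorLeft X)]
    [∀ X : C, PreservesColimitsOfSize.{0, 0} (tensorRight X)] (V : C) :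
    (∀ p q : ℕ, ∃ e : (forms V p 0).tensorBimod (forms V 0 q) ≅ forms V p q,
      projTensor (forms V p 0) (forms V 0 q) ≫ e.hom.hom =
        wedge V (show (p, 0) + (0, q) = (p, q) by simp) ∧
      e.inv.hom = splitHolAnti V p q) ∧
    (∀ p q : ℕ, ∃ e : (forms V 0 q).tensorBimod (forms V p 0) ≅ forms V p q,
      projTensor (forms V 0 q) (forms V p 0) ≫ e.hom.hom =
        wedge V (show (0, q) + (p, 0) = (p, q) by simp) ∧
      e.inv.hom = splitAntiHol V p q) ∧
    IsFactorisable (coordinateHom V) := by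
  -- By definition `coordinateHom V` is `φ.superTensor (braidedExterior V)`, and the embeddings in
  -- `splitHolAnti` and `splitAntiHol` are `GradedMon.superInl` and `GradedMon.superInr`, so the
  -- general results apply by unfolding.
  let φ := DegreeZeroHom.tensorMon (braidedExterior V) (braidedSymmetric V)
  have h₁ := exists_superTensor_iso φ (braidedExterior V)
  have h₂ := exists_superTensor_iso_swap φ (braidedExterior V)
  refine ⟨fun p q => h₁ p q (by simp), fun p q => h₂ p q (by simp), fun p q => ⟨?_, ?_⟩⟩
  · obtain ⟨e, he, -⟩ := h₁ p q (by simp)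
    exact ⟨e, he⟩
  · obtain ⟨e, he, -⟩ := h₂ p q (by simp)
    exact ⟨e, he⟩
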